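/- Let $(\Omega,\mathscr F,\mathbb P)$ be a probability space and $X$ a Polish space with Borel $\sigma$-algebra $\mathscr B(X)$. A *stochastic flow* is a family of maps $S(t,s;\omega):X\to X$ ($s\le t$ real, $\omega\in\Omega$) such that $(s,\omega)\mapsto S(t,s;\omega)x$ is $\mathscr B((-\infty,t])\otimes\mathscr F$-measurable on $(-\infty,t]\times\Omega$ for all $t\in\mathbb R$, $x\in X$, and such that for $\mathbb P$-almost every $\omega$: $S(t,r;\omega)S(r,s;\omega)=S(t,s;\omega)$ for all $s\le r\le t$, $x\mapsto S(t,s;\omega)x$ is continuous for all $s\le t$, and $S(t,t;\omega)=\mathrm{id}_X$ for all $t$. Let $\mathcal F_{\ge s}$ and $\mathcal F_{\le s}$ be the completions with respect to $\mathbb P$ (adjoining all subsets of $\mathbb P$-null sets) of $\sigma\{S(u,t;\cdot)x : s\le t\le u,\ x\in X\}$ and $\sigma\{S(u,t;\cdot)x : t\le u\le s,\ x\in X\}$. The flow is a *white noise* stochastic flow if $\mathcal F_{\ge s}$ and $\mathcal F_{\le s}$ are independent for every $s\in\mathbb R$. For $s\le t$ and bounded measurable $f:X\to\mathbb R$ put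 $P_{st}f(x)=\mathbb E f(S(t,s;\omega)x)$; for a Borel probability measure $\rho$ on $X$ let $P_{st}\rho$ be the Borel probability measure with $\int f\,d(P_{st}\rho)=\int P_{st}f\,d\rho$ for all bounded measurable $f$. An *evolution system of measures for $\{P_{st}\}$* is a family $\{\rho_s\}_{s\in\mathbb R}$ of Borel probability measures on $X$ with $P_{st}\rho_s=\rho_t$ for all $s\le t$. An *evolution system of measures for $S$* is a family $\{\mu_s\}_{s\in\mathbb R}$ of probability measures on $(\Omega\times X,\mathscr F\otimes\mathscr B(X))$ with marginal $\mathbb P$ on $\Omega$ such that, for all $s\le t$, $\mu_t$ is the image of $\mu_s$ under $(\omega,x)\mapsto(\omega,S(t,s;\omega)x)$. The disintegration of $\mu_t$ is denoted $\mu_{t\omega}$: each $\mu_{t\omega}$ is a Borel probability measure on $X$, $\omega\mapsto\mu_{t\omega}(B)$ is $\mathscr F$-measurable and $\mu_t(A\times B)=\int_A\mu_{t\omega}(B)\,d\mathbb P(\omega)$ for $A\in\mathscr F$, $B\in\mathscr B(X)$. We say that $\mu_t$ is *$\mathcal F_{\le t}$-measurable* if $\omega\mapsto\mu_{t\omega}(B)$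 is $\mathcal F_{\le t}$-measurable for every $B\in\mathscr B(X)$. **Theorem 1.1.** Let $S$ be a white noise stochastic flow with associated Markov semigroup $\{P_{st}\}$. (a) Let $\{\rho_s\}$ be an evolution system of measures for $\{P_{st}\}$. Then there are probability measures $\mu_t$, $t\in\mathbb R$, on $\Omega\times X$ with disintegrations $\mu_{t\omega}$ such that for every $t\in\mathbb R$ and every deterministic real sequence $s_n\to-\infty$, for $\mathbb P$-almost every $\omega$ (the exceptional null set may depend on $t$ and on the sequence), the image measures $S(t,s_n;\omega)\rho_{s_n}$ (defined as soon as $s_n\le t$) converge weakly to $\mu_{t\omega}$ as $n\to\infty$. Moreover (i) $\{\mu_t\}$ is an evolution system of measures for $S$; (ii) $\mu_t$ is $\mathcal F_{\le t}$-measurable for every $t\in\mathbb R$; (iii) $\mathbb E(\mu_{t\omega}(B))=\rho_t(B)$ for all $t\in\mathbb R$ and $B\in\mathscr B(X)$. (b) Conversely, if $\{\mu_t\}$ is an evolution system of measures for $S$ such that $\mu_t$ is $\mathcal F_{\le t}$-measurable for every $t\in\mathbb R$, then $$\rho_t(B)=\int_\Omega\mu_{t\omega}(B)\,d\mathbb P(\omega),\qquad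 t\in\mathbb R,\ B\in\mathscr B(X),$$ defines an evolution system of measures for $\{P_{st}\}$. -/

import Mathlib

open MeasureTheory ProbabilityTheory Filter Topology
open scoped BoundedContinuousFunction

namespace StochFlow

variable {Ω X : Type*} [MeasurableSpace Ω] [TopologicalSpace X] [MeasurableSpace X]

/-- `S t s ω x` stands for `S(t,s;ω)x`; only the values with `s ≤ t` are meaningful, and nothing is
required of the others. -/
structure IsStochasticFlow (P : Measure Ω) (S : ℝ → ℝ → Ω → X → X) : Prop where
  ae_flow : ∀ᵐ ω ∂P,
    (∀ s r t : ℝ, s ≤ r → r ≤ t → ∀ x : X, S t r ω (S r s ω x) = S t s ω x) ∧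
    (∀ s t : ℝ, s ≤ t → Continuous (S t s ω)) ∧
    (∀ t : ℝ, ∀ x : X, S t t ω x = x)
  measurable_flow : ∀ (t : ℝ) (x : X), Measurable fun p : Set.Iic t × Ω => S t p.1 p.2 x

/-- The completion with respect to `P` of a σ-algebra `m` on `Ω`: the sets that differ from a member
of `m` by a subset of a `P`-null set. -/
def completion (P : Measure Ω) (m : MeasurableSpace Ω) : MeasurableSpace Ω :=
  eventuallyMeasurableSpace m (ae P)

/-- The completed future `𝓕_{≥ s}`, generated by `S(u,t;·)x` for `s ≤ t ≤ u` and `x ∈ X`. -/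
def future (P : Measure Ω) (S : ℝ → ℝ → Ω → X → X) (s : ℝ) : MeasurableSpace Ω :=
  completion P (⨆ (t : ℝ) (u : ℝ) (_ : s ≤ t) (_ : t ≤ u) (x : X),
    MeasurableSpace.comap (fun ω => S u t ω x) inferInstance)

/-- The completed past `𝓕_{≤ s}`, generated by `S(u,t;·)x` for `t ≤ u ≤ s` and `x ∈ X`. -/
def past (P : Measure Ω) (S : ℝ → ℝ → Ω → X → X) (s : ℝ) : MeasurableSpace Ω :=
  completion P (⨆ (t : ℝ) (u : ℝ) (_ : t ≤ u) (_ : u ≤ s) (x : X),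
    MeasurableSpace.comap (fun ω => S u t ω x) inferInstance)

structure IsWhiteNoiseFlow (P : Measure Ω) (S : ℝ → ℝ → Ω → X → X) : Prop
    extends IsStochasticFlow P S where
  indep : ∀ s : ℝ, Indep (future P S s) (past P S s) P

/-- An evolution system of measures for the flow: measures on `Ω × X` with marginal `P` on `Ω`, such
that `μ t` is the image of `μ s` under `(ω, x) ↦ (ω, S(t,s;ω)x)` for `s ≤ t`. -/
structure IsFlowEvolutionSystem (P : Measure Ω) (S : ℝ → ℝ → Ω → X → X)
    (μ : ℝ → Measure (Ω × X)) : Prop where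
  isProbabilityMeasure : ∀ s : ℝ, IsProbabilityMeasure (μ s)
  marginal : ∀ s : ℝ, (μ s).map Prod.fst = P
  map_flow : ∀ s t : ℝ, s ≤ t → (μ s).map (fun p => (p.1, S t s p.1 p.2)) = μ t

/-- `κ` is a disintegration `(μ_ω)` of the measure `μ` on `Ω × X`: each `μ_ω` is a probability
measure, `ω ↦ μ_ω(B)` is measurable, and `μ(A × B) = ∫_A μ_ω(B) dP(ω)`. -/
structure IsDisintegration (P : Measure Ω) (μ : Measure (Ω × X)) (κ : Kernel Ω X) : Prop where
  isMarkovKernel : IsMarkovKernel κ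
  prod_apply : ∀ (A : Set Ω) (B : Set X), MeasurableSet A → MeasurableSet B →
    μ (A ×ˢ B) = ∫⁻ ω in A, κ ω B ∂P

/-- The random measure `κ` is measurable with respect to `𝓕_{≤ t}`. -/
def IsPastMeasurable (P : Measure Ω) (S : ℝ → ℝ → Ω → X → X) (t : ℝ) (κ : Kernel Ω X) : Prop :=
  ∀ B : Set X, MeasurableSet B → Measurable[past P S t] fun ω => κ ω B

/-- The transition operator `P_{st} f (x) = 𝔼 f(S(t,s;ω)x)`. -/
noncomputable def markovOp (P : Measure Ω) (S : ℝ → ℝ → Ω → X → X) (s t : ℝ) (f : X → ℝ) (x : X) :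
    ℝ :=
  ∫ ω, f (S t s ω x) ∂P

/-- An evolution system of measures for a family `T` of transition operators: Borel probability
measures with `T_{st} ρ_s = ρ_t` for `s ≤ t`, where the image measure `T_{st} ρ` is characterised by
`∫ f d(T_{st} ρ) = ∫ T_{st} f dρ` for bounded measurable `f`. -/
structure IsMarkovEvolutionSystem (T : ℝ → ℝ → (X → ℝ) → X → ℝ) (ρ : ℝ → Measure X) : Prop where
  isProbabilityMeasure : ∀ s : ℝ, IsProbabilityMeasure (ρ s)
  image_eq : ∀ s t : ℝ, s ≤ t → ∀ f : X → ℝ, Measurable f → (∃ C : ℝ, ∀ x, |f x| ≤ C) →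
    ∫ x, f x ∂(ρ t) = ∫ x, T s t f x ∂(ρ s)

/-- Weak convergence of a sequence of measures. -/
def WeaklyConverges (ν : ℕ → Measure X) (ν' : Measure X) : Prop :=
  ∀ f : X →ᵇ ℝ, Tendsto (fun n => ∫ x, f x ∂(ν n)) atTop (𝓝 (∫ x, f x ∂ν'))

end StochFlow

/-! Fix `t` and a Borel set `B` and put `M_s(ω) = ρ_s(S(t,s;ω)⁻¹B)`. For `r ≤ s` the random measure
`S(s,r)ρ_r` depends only on the past of `s`, is independent of the future of `s`, and has mean
`ρ_s`; so by the flow property averaging `M_r` over events of the future of `s` gives `M_s`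
(`setLIntegral_imageKernel`). The futures grow as `s` decreases, hence `M` is a bounded martingale
as `s → -∞` and converges almost surely for every Borel `B`, not just against continuous functions.

The limits form a random measure because their mean is the measure `ρ_t`: a monotone inequality
between limits whose two sides have equal means is an almost sure equality (`ae_iSup_setLimsup`,
`ae_iInf_setLimsup`). No tightness is needed. Equivariance follows from weak convergence and
continuity of the flow.

For (b), the same independence argument, on the whole of `Ω`, replaces `μ_{sω}` by its mean `ρ_s`.
-/

namespace StochFlow

/-! ### Sequences of times and weak convergence. -/

/-- A real sequence tending to `-∞` is a reindexing of a strictly decreasing one. -/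
lemma exists_strictAnti_reindex {u : ℕ → ℝ} (hu : Tendsto u atTop atBot) :
    ∃ (d : ℕ → ℝ) (k : ℕ → ℕ), StrictAnti d ∧ (∀ n, ∃ j, d n = u j) ∧ (∀ n, d (k n) = u n) ∧
      Tendsto k atTop atTop := by
  -- Finitely many values lie above any level, so the range can be listed downwards: start at its
  -- maximum and pass each time to the next largest value.
  have hfin : ∀ a : ℝ, {x ∈ Set.range u | a ≤ x}.Finite := by
    intro a
    obtain ⟨N, hN⟩ := eventually_atTop.1 (hu.eventually (eventually_lt_atBot a))
    refine ((Set.finite_lt_nat N).image u).subset ?_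
    rintro _ ⟨⟨n, rfl⟩, hn⟩
    refine ⟨n, ?_, rfl⟩
    by_contra h
    exact absurd (hN n (not_lt.1 h)) (not_lt.2 hn)
  have hmax : ∀ s : Set ℝ, s ⊆ Set.range u → s.Nonempty → ∃ m ∈ s, ∀ x ∈ s, x ≤ m := by
    rintro s hs ⟨a, ha⟩
    have hf : {x ∈ s | a ≤ x}.Finite := (hfin a).subset fun x hx => ⟨hs hx.1, hx.2⟩
    obtain ⟨m, hm, hmm⟩ := Set.exists_max_image _ id hf ⟨a, ha, le_rfl⟩
    refine ⟨m, hm.1, fun x hx => ?_⟩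
    rcases le_total a x with h | h
    · exact hmm x ⟨hx, h⟩
    · exact h.trans hm.2
  have hnext : ∀ y : Set.range u, ∃ m : Set.range u, m.1 < y.1 ∧
      ∀ n, u n < y.1 → u n ≤ m.1 := by
    intro y
    obtain ⟨n, hn⟩ := (hu.eventually (eventually_lt_atBot y.1)).exists
    obtain ⟨m, hm, hmm⟩ := hmax {x ∈ Set.range u | x < y.1} (fun x hx => hx.1) ⟨u n, ⟨n, rfl⟩, hn⟩
    exact ⟨⟨m, hm.1⟩, hm.2, fun n hn => hmm _ ⟨⟨n, rfl⟩, hn⟩⟩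
  obtain ⟨m₀, hm₀, hm₀'⟩ := hmax (Set.range u) subset_rfl ⟨u 0, 0, rfl⟩
  choose next hlt hle using hnext
  let d : ℕ → Set.range u := fun n => next^[n] ⟨m₀, hm₀⟩
  have hd : ∀ n, d (n + 1) = next (d n) := fun n => Function.iterate_succ_apply' _ _ _
  have hanti : StrictAnti fun n => (d n).1 := strictAnti_nat_of_succ_lt fun n => by
    rw [hd]; exact hlt _
  have hhit : ∀ n, ∃ k, (d k).1 = u n := by
    intro n
    -- A value never reached would lie below the whole infinite list, contradicting `hfin`.
    by_contra! h
    have hall : ∀ k, u n < (d k).1 := by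
      intro k
      induction k with
      | zero => exact lt_of_le_of_ne (hm₀' _ ⟨n, rfl⟩) (h 0).symm
      | succ k ih =>
        refine lt_of_le_of_ne ?_ (h _).symm
        rw [hd]; exact hle _ _ ih
    refine Set.infinite_range_of_injective hanti.injective ((hfin (u n)).subset ?_)
    rintro _ ⟨k, rfl⟩
    exact ⟨(d k).2, (hall k).le⟩
  choose k hk using hhit
  refine ⟨fun n => (d n).1, k, hanti, fun n => ?_, hk, ?_⟩
  · obtain ⟨j, hj⟩ := (d n).2
    exact ⟨j, hj.symm⟩
  · refine tendsto_atTop.2 fun K => ?_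
    filter_upwards [hu.eventually (eventually_lt_atBot (d K).1)] with n hn
    by_contra h
    rw [← hk n] at hn
    exact absurd hn (not_lt.2 (hanti.antitone (not_le.1 h).le))

/-- Weak convergence to a probability measure can be tested on a countable family of sets. -/
lemma exists_countable_weakConvergenceDetermining (X : Type*) [TopologicalSpace X] [PolishSpace X]
    [MeasurableSpace X] [BorelSpace X] :
    ∃ 𝒰 : Set (Set X), 𝒰.Countable ∧ (∀ U ∈ 𝒰, MeasurableSet U) ∧
      ∀ (ν : ℕ → Measure X) (ν' : Measure X), (∀ᶠ n in atTop, IsProbabilityMeasure (ν n)) →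
        IsProbabilityMeasure ν' → (∀ U ∈ 𝒰, Tendsto (fun n => ν n U) atTop (𝓝 (ν' U))) →
        WeaklyConverges ν ν' := by
  -- Finite intersections of a countable basis: still countable, and now a π-system.
  let b : Finset (TopologicalSpace.countableBasis X) → Set X := fun F => ⋂ U ∈ F, U.1
  have hopen : ∀ F, IsOpen (b F) := fun F => isOpen_biInter_finset fun U _ =>
    TopologicalSpace.isOpen_of_mem_countableBasis U.2
  have : Countable (TopologicalSpace.countableBasis X) :=
    (TopologicalSpace.countable_countableBasis X).to_subtype
  refine ⟨Set.range b, Set.countable_range b, ?_, ?_⟩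
  · rintro _ ⟨F, rfl⟩
    exact (hopen F).measurableSet
  intro ν ν' hν hν' hlim f
  classical
  obtain ⟨N, hN⟩ := eventually_atTop.1 hν
  let μ : ℕ → ProbabilityMeasure X := fun n => ⟨ν (n + N), hN _ (Nat.le_add_left _ _)⟩
  have key : Tendsto μ atTop (𝓝 ⟨ν', hν'⟩) := by
    refine IsPiSystem.tendsto_probabilityMeasure_of_tendsto_of_mem (S := Set.range b) ?_ ?_ ?_ ?_
    · rintro _ ⟨F, rfl⟩ _ ⟨G, rfl⟩ -
      exact ⟨F ∪ G, by ext x; simp only [b, Finset.mem_union, Set.mem_inter_iff, Set.mem_iInter]; grind⟩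
    · rintro _ ⟨F, rfl⟩
      exact (hopen F).measurableSet
    · intro u hu x hx
      obtain ⟨v, hv, hxv, hvu⟩ :=
        (TopologicalSpace.isBasis_countableBasis X).exists_subset_of_mem_open hx hu
      refine ⟨b {⟨v, hv⟩}, ⟨_, rfl⟩, (hopen _).mem_nhds ?_, ?_⟩ <;>
        simpa only [b, Finset.mem_singleton, Set.iInter_iInter_eq_left]
    · rintro _ ⟨F, rfl⟩
      have h1 := (ENNReal.tendsto_toNNReal (measure_ne_top ν' (b F))).comp
        ((hlim _ ⟨F, rfl⟩).comp (tendsto_add_atTop_nat N))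
      exact h1
  exact (tendsto_add_atTop_iff_nat (f := fun n => ∫ x, f x ∂(ν n)) N).1
    (ProbabilityMeasure.tendsto_iff_forall_integral_tendsto.1 key f)

/-! ### Averaging out an independent random measure. -/

/-- A kernel measurable with respect to a σ-algebra independent of `m` may be replaced by its mean
when integrating sets in `m ⊗ 𝓑(X)`. -/
lemma lintegral_kernel_section_eq_of_indep {Ω X : Type*} {m m' mΩ : MeasurableSpace Ω}
    [mX : MeasurableSpace X] {P : Measure Ω} [IsProbabilityMeasure P]
    (hm : m ≤ mΩ) (hm' : m' ≤ mΩ) (hind : Indep m m' P)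
    (κ : Kernel Ω X) [IsMarkovKernel κ]
    (hκ : ∀ B, MeasurableSet B → Measurable[m'] fun ω => κ ω B)
    (ρ : Measure X) [IsProbabilityMeasure ρ] (hρ : ∀ B, MeasurableSet B → ∫⁻ ω, κ ω B ∂P = ρ B)
    {C : Set (Ω × X)} (hC : MeasurableSet[m.prod mX] C) :
    ∫⁻ ω, κ ω (Prod.mk ω ⁻¹' C) ∂P = ∫⁻ ω, ρ (Prod.mk ω ⁻¹' C) ∂P := by
  have hle : m.prod mX ≤ mΩ.prod mX := sup_le_sup (MeasurableSpace.comap_mono hm) le_rfl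
  have hC' : MeasurableSet C := hle _ hC
  rw [← Measure.compProd_apply hC', ← Measure.prod_apply hC']
  -- Both sides are finite measures of `C`, so rectangles suffice; there independence factors the
  -- integral of `1_A · κ(B)`.
  refine ext_on_measurableSpace_of_generate_finite (m := m.prod mX) _ _ ?_ hle
    (@generateFrom_prod Ω X m mX).symm (@isPiSystem_prod Ω X m mX) (by simp) hC
  rintro _ ⟨A, hA, B, hB, rfl⟩
  rw [Measure.compProd_apply_prod (hm _ hA) hB, Measure.prod_prod, ← hρ B hB]
  have h := lintegral_mul_eq_lintegral_mul_lintegral_of_independent_measurableSpace hm hm' hind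
    (f := A.indicator 1) (g := fun ω => κ ω B) ((@measurable_const _ _ _ m _).indicator hA) (hκ B hB)
  rw [lintegral_indicator_one (hm _ hA)] at h
  rw [← h, ← lintegral_indicator (hm _ hA)]
  refine lintegral_congr fun ω => ?_
  by_cases hω : ω ∈ A <;> simp [hω]

/-! ### Setwise limits of random measures. -/

section RandomMeasureLimit

variable {Ω X : Type*} [MeasurableSpace Ω] [MeasurableSpace X] {P : Measure Ω}
  [IsProbabilityMeasure P] {ν : ℕ → Kernel Ω X} {ρ : Measure X}

/-- The upper setwise limit of a sequence of random measures. -/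
noncomputable def setLimsup (ν : ℕ → Kernel Ω X) (B : Set X) (ω : Ω) : ENNReal :=
  limsup (fun n => ν n ω B) atTop

lemma measurable_setLimsup (ν : ℕ → Kernel Ω X) {B : Set X} (hB : MeasurableSet B) :
    Measurable (setLimsup ν B) :=
  Measurable.limsup fun n => (ν n).measurable_coe hB

lemma setLimsup_mono (ν : ℕ → Kernel Ω X) {B C : Set X} (h : B ⊆ C) (ω : Ω) :
    setLimsup ν B ω ≤ setLimsup ν C ω :=
  limsup_le_limsup (.of_forall fun _ => measure_mono h)

lemma setLimsup_univ [∀ n, IsMarkovKernel (ν n)] (ω : Ω) : setLimsup ν Set.univ ω = 1 := by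
  simp [setLimsup]

lemma setLimsup_le_one [∀ n, IsMarkovKernel (ν n)] (B : Set X) (ω : Ω) :
    setLimsup ν B ω ≤ 1 :=
  (setLimsup_mono ν (Set.subset_univ B) ω).trans_eq (setLimsup_univ ω)

omit [IsProbabilityMeasure P] in
lemma ae_tendsto_setLimsup {B : Set X}
    (hconv : ∀ᵐ ω ∂P, ∃ c, Tendsto (fun n => ν n ω B) atTop (𝓝 c)) :
    ∀ᵐ ω ∂P, Tendsto (fun n => ν n ω B) atTop (𝓝 (setLimsup ν B ω)) := by
  filter_upwards [hconv] with ω ⟨c, hc⟩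
  rwa [setLimsup, hc.limsup_eq]

lemma lintegral_setLimsup [∀ n, IsMarkovKernel (ν n)] {B : Set X} (hB : MeasurableSet B)
    (hconv : ∀ᵐ ω ∂P, ∃ c, Tendsto (fun n => ν n ω B) atTop (𝓝 c))
    (hmean : ∀ n, ∫⁻ ω, ν n ω B ∂P = ρ B) :
    ∫⁻ ω, setLimsup ν B ω ∂P = ρ B := by
  have h := tendsto_lintegral_of_dominated_convergence (μ := P) (fun _ => 1)
    (fun n => (ν n).measurable_coe hB) (fun n => .of_forall fun ω => prob_le_one) (by simp)
    (ae_tendsto_setLimsup hconv)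
  simp only [hmean] at h
  exact tendsto_nhds_unique h tendsto_const_nhds

variable [IsFiniteMeasure ρ] [∀ n, IsMarkovKernel (ν n)]
  (hconv : ∀ B, MeasurableSet B → ∀ᵐ ω ∂P, ∃ c, Tendsto (fun n => ν n ω B) atTop (𝓝 c))
  (hmean : ∀ n B, MeasurableSet B → ∫⁻ ω, ν n ω B ∂P = ρ B)
include hconv hmean

/-- The inequality `≤` holds pointwise by monotonicity, and both sides have integral `ρ (⋃ i, B i)`,
by monotone convergence and continuity of `ρ`. The exceptional null set depends on the family. -/
lemma ae_iSup_setLimsup {ι : Type*} [Countable ι] {B : ι → Set X}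
    (hB : ∀ i, MeasurableSet (B i)) (hd : Directed (· ⊆ ·) B) :
    ∀ᵐ ω ∂P, ⨆ i, setLimsup ν (B i) ω = setLimsup ν (⋃ i, B i) ω := by
  have hU : MeasurableSet (⋃ i, B i) := .iUnion hB
  have h1 : ∫⁻ ω, ⨆ i, setLimsup ν (B i) ω ∂P = ρ (⋃ i, B i) := by
    rw [lintegral_iSup_directed (fun i => (measurable_setLimsup ν (hB i)).aemeasurable),
      hd.measure_iUnion]
    · exact iSup_congr fun i => lintegral_setLimsup (hB i) (hconv _ (hB i)) fun n => hmean n _ (hB i)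
    · exact fun i j => (hd i j).imp fun _ h => ⟨setLimsup_mono ν h.1, setLimsup_mono ν h.2⟩
  have h2 := lintegral_setLimsup hU (hconv _ hU) fun n => hmean n _ hU
  refine ae_eq_of_ae_le_of_lintegral_le ?_ (h1 ▸ measure_ne_top _ _)
    (measurable_setLimsup ν hU).aemeasurable (h2.trans h1.symm).le
  exact .of_forall fun ω => iSup_le fun i => setLimsup_mono ν (Set.subset_iUnion B i) ω

lemma ae_iInf_setLimsup {ι : Type*} [Countable ι] [Nonempty ι] {B : ι → Set X}
    (hB : ∀ i, MeasurableSet (B i)) (hd : Directed (· ⊇ ·) B) :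
    ∀ᵐ ω ∂P, ⨅ i, setLimsup ν (B i) ω = setLimsup ν (⋂ i, B i) ω := by
  have hU : MeasurableSet (⋂ i, B i) := .iInter hB
  have hint : ∀ {C : Set X}, MeasurableSet C → ∫⁻ ω, setLimsup ν C ω ∂P = ρ C := fun hC =>
    lintegral_setLimsup hC (hconv _ hC) fun n => hmean n _ hC
  have h1 : ∫⁻ ω, ⨅ i, setLimsup ν (B i) ω ∂P = ρ (⋂ i, B i) := by
    rw [lintegral_iInf_directed_of_measurable (IsProbabilityMeasure.ne_zero P)
      (fun i => measurable_setLimsup ν (hB i)), hd.measure_iInter (fun i => (hB i).nullMeasurableSet)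
      ⟨Classical.arbitrary ι, measure_ne_top _ _⟩]
    · exact iInf_congr fun i => hint (hB i)
    · exact fun i => by rw [hint (hB i)]; exact measure_ne_top _ _
    · exact fun i j => (hd i j).imp fun _ h => ⟨setLimsup_mono ν h.1, setLimsup_mono ν h.2⟩
  refine (ae_eq_of_ae_le_of_lintegral_le ?_ (hint hU ▸ measure_ne_top _ _)
    (Measurable.iInf fun i => measurable_setLimsup ν (hB i)).aemeasurable
    (h1.trans (hint hU).symm).le).symm
  exact .of_forall fun ω => le_iInf fun i => setLimsup_mono ν (Set.iInter_subset B i) ω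

end RandomMeasureLimit

/-- A sequence of random probability measures on `ℝ` with constant mean which almost surely
converges on each Borel set, converges setwise to a random probability measure. -/
lemma exists_kernel_ae_tendsto_real {Ω : Type*} [MeasurableSpace Ω] {P : Measure Ω}
    [IsProbabilityMeasure P] {ν : ℕ → Kernel Ω ℝ} [∀ n, IsMarkovKernel (ν n)] {ρ : Measure ℝ}
    [IsFiniteMeasure ρ]
    (hconv : ∀ B, MeasurableSet B → ∀ᵐ ω ∂P, ∃ c, Tendsto (fun n => ν n ω B) atTop (𝓝 c))
    (hmean : ∀ n B, MeasurableSet B → ∫⁻ ω, ν n ω B ∂P = ρ B) :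
    ∃ κ : Kernel Ω ℝ, IsMarkovKernel κ ∧
      ∀ B, MeasurableSet B → ∀ᵐ ω ∂P, Tendsto (fun n => ν n ω B) atTop (𝓝 (κ ω B)) := by
  let f : Ω → ℚ → ℝ := fun ω q => (setLimsup ν (Set.Iic (q : ℝ)) ω).toReal
  have hf : Measurable f := measurable_pi_lambda _ fun q =>
    (measurable_setLimsup ν measurableSet_Iic).ennreal_toReal
  have hne : ∀ B ω, setLimsup ν B ω ≠ ⊤ := fun B ω =>
    ((setLimsup_le_one B ω).trans_lt ENNReal.one_lt_top).ne
  have hmono : ∀ ω, Monotone fun q : ℚ => setLimsup ν (Set.Iic (q : ℝ)) ω := fun ω q r hqr =>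
    setLimsup_mono ν (Set.Iic_subset_Iic.2 (by exact_mod_cast hqr)) ω
  -- Limits at `±∞` and right continuity each concern countably many families of half-lines, so one
  -- null set suffices.
  have hstieltjes : ∀ᵐ ω ∂P, IsRatStieltjesPoint f ω := by
    have htop := ae_iSup_setLimsup hconv hmean (B := fun q : ℚ => Set.Iic (q : ℝ))
      (fun _ => measurableSet_Iic) (Monotone.directed_le fun q r hqr =>
        Set.Iic_subset_Iic.2 (by exact_mod_cast hqr))
    have hbot := ae_iInf_setLimsup hconv hmean (B := fun q : ℚ => Set.Iic (q : ℝ))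
      (fun _ => measurableSet_Iic) (Monotone.directed_ge fun q r hqr =>
        Set.Iic_subset_Iic.2 (by exact_mod_cast hqr))
    have hright : ∀ᵐ ω ∂P, ∀ t : ℚ, ⨅ r : Set.Ioi t, setLimsup ν (Set.Iic ((r : ℚ) : ℝ)) ω =
        setLimsup ν (Set.Iic (t : ℝ)) ω := by
      refine ae_all_iff.2 fun t => ?_
      have h := ae_iInf_setLimsup hconv hmean (B := fun r : Set.Ioi t => Set.Iic ((r : ℚ) : ℝ))
        (fun _ => measurableSet_Iic) (Monotone.directed_ge fun q r hqr =>
          Set.Iic_subset_Iic.2 (by exact_mod_cast hqr))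
      have hI : ⋂ r : Set.Ioi t, Set.Iic ((r : ℚ) : ℝ) = Set.Iic (t : ℝ) := by
        ext x
        simp only [Set.mem_iInter, Set.mem_Iic, Subtype.forall, Set.mem_Ioi]
        refine ⟨fun h => le_of_forall_lt_rat_imp_le fun r hr => h r (by exact_mod_cast hr),
          fun h r hr => h.trans (by exact_mod_cast hr.le)⟩
      rwa [hI] at h
    filter_upwards [htop, hbot, hright] with ω htop hbot hright
    rw [Real.iUnion_Iic_rat, setLimsup_univ] at htop
    rw [Real.iInter_Iic_rat, show setLimsup ν ∅ ω = 0 by simp [setLimsup]] at hbot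
    refine ⟨fun q r hqr => ENNReal.toReal_mono (hne _ _) (hmono ω hqr), ?_, ?_, fun t => ?_⟩
    · have h := tendsto_atTop_iSup (hmono ω)
      rw [htop] at h
      exact (ENNReal.tendsto_toReal ENNReal.one_ne_top).comp h
    · have h := tendsto_atBot_iInf (hmono ω)
      rw [hbot] at h
      exact (ENNReal.tendsto_toReal ENNReal.zero_ne_top).comp h
    · rw [← ENNReal.toReal_iInf fun _ => hne _ _, hright]
  let κ : Kernel Ω ℝ := ⟨fun ω => (stieltjesOfMeasurableRat f hf ω).measure,
    measurable_measure_stieltjesOfMeasurableRat hf⟩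
  have hκ : IsMarkovKernel κ := ⟨fun ω => instIsProbabilityMeasure_stieltjesOfMeasurableRat hf ω⟩
  refine ⟨κ, hκ, ?_⟩
  refine MeasurableSpace.induction_on_inter
    ((BorelSpace.measurable_eq (α := ℝ)).trans Real.borel_eq_generateFrom_Iic_rat)
    Real.isPiSystem_Iic_rat ?_ ?_ ?_ ?_
  · simp
  · intro B hB
    obtain ⟨q, rfl⟩ := by simpa using hB
    filter_upwards [hstieltjes, ae_tendsto_setLimsup (hconv _ (measurableSet_Iic (a := (q : ℝ))))]
      with ω hω hlim
    convert hlim using 2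
    change (stieltjesOfMeasurableRat f hf ω).measure (Set.Iic (q : ℝ)) = _
    rw [measure_stieltjesOfMeasurableRat_Iic, stieltjesOfMeasurableRat_eq,
      toRatCDF_of_isRatStieltjesPoint hω, ENNReal.ofReal_toReal (hne _ _)]
  · intro B hB h
    filter_upwards [h] with ω hω
    simp only [prob_compl_eq_one_sub hB]
    exact ENNReal.Tendsto.sub tendsto_const_nhds hω (Or.inl ENNReal.one_ne_top)
  · intro B hdisj hB h
    -- Termwise convergence does not pass to infinite sums; the almost sure continuity along partial
    -- unions does it instead.
    let U : ℕ → Set ℝ := fun n => ⋃ i ∈ Finset.range n, B i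
    have hU : ∀ n, MeasurableSet (U n) := fun n => Finset.measurableSet_biUnion _ fun i _ => hB i
    have hUU : ⋃ n, U n = ⋃ i, B i := by
      ext x
      simp only [U, Set.mem_iUnion, Finset.mem_range, exists_prop]
      exact ⟨fun ⟨_, i, _, hx⟩ => ⟨i, hx⟩, fun ⟨i, hx⟩ => ⟨i + 1, i, Nat.lt_succ_self i, hx⟩⟩
    have hUmono : Monotone U := fun m n hmn => Set.biUnion_subset_biUnion_left fun i hi =>
      Finset.mem_coe.2 (Finset.range_mono hmn hi)
    have hsup := ae_iSup_setLimsup hconv hmean hU hUmono.directed_le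
    rw [hUU] at hsup
    filter_upwards [ae_all_iff.2 h, hsup, ae_tendsto_setLimsup (hconv _ (.iUnion hB))]
      with ω hω hsup hlim
    convert hlim using 2
    rw [← hsup, ← hUU, hUmono.measure_iUnion]
    refine iSup_congr fun n => ?_
    have hsum : ∀ μ : Measure ℝ, μ (U n) = ∑ i ∈ Finset.range n, μ (B i) := fun μ =>
      measure_biUnion_finset (hdisj.set_pairwise _) fun i _ => hB i
    have ht : Tendsto (fun k => ν k ω (U n)) atTop (𝓝 (κ ω (U n))) := by
      simp only [hsum]
      exact tendsto_finsetSum _ fun i _ => hω i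
    exact ht.limsup_eq.symm

/-- A sequence of random probability measures with constant mean which almost surely converges on
each Borel set, converges setwise to a random probability measure. -/
lemma exists_kernel_ae_tendsto {Ω X : Type*} [MeasurableSpace Ω] [MeasurableSpace X]
    [StandardBorelSpace X] [Nonempty X] {P : Measure Ω}
    [IsProbabilityMeasure P] {ν : ℕ → Kernel Ω X} [∀ n, IsMarkovKernel (ν n)] {ρ : Measure X}
    [IsFiniteMeasure ρ]
    (hconv : ∀ B, MeasurableSet B → ∀ᵐ ω ∂P, ∃ c, Tendsto (fun n => ν n ω B) atTop (𝓝 c))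
    (hmean : ∀ n B, MeasurableSet B → ∫⁻ ω, ν n ω B ∂P = ρ B) :
    ∃ κ : Kernel Ω X, IsMarkovKernel κ ∧
      ∀ B, MeasurableSet B → ∀ᵐ ω ∂P, Tendsto (fun n => ν n ω B) atTop (𝓝 (κ ω B)) := by
  classical
  have he : MeasurableEmbedding (embeddingReal X) := measurableEmbedding_embeddingReal X
  set e := embeddingReal X
  have hmap : ∀ n ω (B : Set ℝ), MeasurableSet B → (ν n).map e ω B = ν n ω (e ⁻¹' B) :=
    fun n ω B hB => Kernel.map_apply' _ he.measurable _ hB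
  have hM : ∀ n, IsMarkovKernel ((ν n).map e) := fun n => Kernel.IsMarkovKernel.map _ he.measurable
  obtain ⟨η, hη, hlim⟩ := exists_kernel_ae_tendsto_real (P := P) (ν := fun n => (ν n).map e)
    (ρ := ρ.map e)
    (fun B hB => by simp only [hmap _ _ _ hB]; exact hconv _ (he.measurable hB))
    (fun n B hB => by
      simp only [hmap _ _ _ hB, Measure.map_apply he.measurable hB]
      exact hmean n _ (he.measurable hB))
  -- `s` has full measure, since every approximating measure gives the range mass `1`. Off `s` a
  -- Dirac mass keeps the kernel Markov.
  let s : Set Ω := {ω | η ω (Set.range e) = 1}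
  have hs : MeasurableSet s := η.measurable_coe he.measurableSet_range (measurableSet_singleton 1)
  let κ : Kernel Ω X := Kernel.piecewise hs (Kernel.comapRight η he)
    (Kernel.const Ω (Measure.dirac (Classical.arbitrary X)))
  have hκ : ∀ ω ∈ s, ∀ B, MeasurableSet B → κ ω B = η ω (e '' B) := fun ω hω B hB => by
    simp only [κ, Kernel.piecewise_apply', if_pos hω, Kernel.comapRight_apply' _ _ _ hB]
  refine ⟨κ, ⟨fun ω => ⟨?_⟩⟩, fun B hB => ?_⟩
  · by_cases hω : ω ∈ s
    · rw [hκ ω hω _ .univ, Set.image_univ]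
      exact hω
    · simp [κ, Kernel.piecewise_apply', if_neg hω]
  · filter_upwards [hlim _ he.measurableSet_range, hlim _ (he.measurableSet_image.2 hB)]
      with ω h1 h2
    simp only [hmap _ _ _ he.measurableSet_range, Set.preimage_range, measure_univ] at h1
    have hω : ω ∈ s := tendsto_nhds_unique h1 tendsto_const_nhds
    simp only [hmap _ _ _ (he.measurableSet_image.2 hB), Set.preimage_image_eq _ he.injective] at h2
    rwa [hκ ω hω _ hB]

/-! ### Perfect flows and their random images. -/

/-- A white noise flow all of whose defining properties hold for every `ω`, with future and past
σ-algebras `F` and `H` contained in the ambient one. -/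
structure IsPerfectFlow {Ω X : Type*} [mΩ : MeasurableSpace Ω] [TopologicalSpace X]
    [MeasurableSpace X] (P : Measure Ω) (S : ℝ → ℝ → Ω → X → X) (F H : ℝ → MeasurableSpace Ω) :
    Prop where
  future_le : ∀ s, F s ≤ mΩ
  past_le : ∀ s, H s ≤ mΩ
  future_antitone : Antitone F
  indep : ∀ s, Indep (F s) (H s) P
  flow : ∀ ω s r t, s ≤ r → r ≤ t → ∀ x, S t r ω (S r s ω x) = S t s ω x
  continuous : ∀ ω s t, s ≤ t → Continuous (S t s ω)
  measurable_future : ∀ s t, s ≤ t → ∀ x, Measurable[F s] fun ω => S t s ω x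
  measurable_past : ∀ s t, s ≤ t → ∀ x, Measurable[H t] fun ω => S t s ω x

/-- The random image of a measure under a random map. -/
noncomputable def imageKernel {Ω X : Type*} [MeasurableSpace Ω] [MeasurableSpace X]
    (φ : Ω → X → X) (ρ : Measure X) : Kernel Ω X :=
  (Kernel.id ×ₖ Kernel.const Ω ρ).map (Function.uncurry φ)

section ImageKernel

variable {Ω X : Type*} [MeasurableSpace Ω] [MeasurableSpace X] {φ : Ω → X → X}

lemma imageKernel_apply (hφ : Measurable (Function.uncurry φ)) (ρ : Measure X) [SFinite ρ] (ω : Ω) :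
    imageKernel φ ρ ω = ρ.map (φ ω) := by
  rw [imageKernel, Kernel.map_apply _ hφ, Kernel.prod_apply, Kernel.id_apply, Kernel.const_apply,
    Measure.dirac_prod, Measure.map_map hφ measurable_prodMk_left]
  rfl

lemma imageKernel_apply' (hφ : Measurable (Function.uncurry φ)) (ρ : Measure X) [SFinite ρ] (ω : Ω)
    {B : Set X} (hB : MeasurableSet B) : imageKernel φ ρ ω B = ρ (φ ω ⁻¹' B) := by
  rw [imageKernel_apply hφ, Measure.map_apply hφ.of_uncurry_left hB]

lemma isMarkovKernel_imageKernel (hφ : Measurable (Function.uncurry φ)) (ρ : Measure X)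
    [IsProbabilityMeasure ρ] : IsMarkovKernel (imageKernel φ ρ) :=
  Kernel.IsMarkovKernel.map _ hφ

end ImageKernel

namespace IsPerfectFlow

variable {Ω X : Type*} {m : MeasurableSpace Ω} [mΩ : MeasurableSpace Ω] [TopologicalSpace X]
  [PolishSpace X]
  [mX : MeasurableSpace X] [BorelSpace X] {P : Measure Ω} [IsProbabilityMeasure P]
  {S : ℝ → ℝ → Ω → X → X} {F H : ℝ → MeasurableSpace Ω}

-- Continuity in `x` upgrades measurability in `ω` to joint measurability. The σ-algebra `m` stays
-- free, to be specialised to futures and pasts.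
omit [IsProbabilityMeasure P] in
lemma measurable_uncurry_of (hS : IsPerfectFlow P S F H) {s t : ℝ}
    (hst : s ≤ t) (hm : ∀ x, Measurable[m] fun ω => S t s ω x) :
    Measurable[m.prod mX] (Function.uncurry (S t s)) := by
  have h := measurable_uncurry_of_continuous_of_measurable (m := m)
    (u := fun (x : X) (ω : Ω) => S t s ω x) (fun ω => hS.continuous ω s t hst) hm
  exact h.comp (@measurable_swap Ω X m mX)

omit [IsProbabilityMeasure P] in
lemma measurable_uncurry (hS : IsPerfectFlow P S F H) {s t : ℝ} (hst : s ≤ t) :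
    Measurable (Function.uncurry (S t s)) :=
  hS.measurable_uncurry_of hst fun x => (hS.measurable_past s t hst x).mono (hS.past_le t) le_rfl

omit [IsProbabilityMeasure P] in
lemma measurable_imageKernel_of (hS : IsPerfectFlow P S F H) {s t : ℝ}
    (hst : s ≤ t) (hm : ∀ x, Measurable[m] fun ω => S t s ω x) (ρ : Measure X)
    [IsProbabilityMeasure ρ] {B : Set X} (hB : MeasurableSet B) :
    Measurable[m] fun ω => imageKernel (S t s) ρ ω B := by
  simp only [imageKernel_apply' (hS.measurable_uncurry hst) ρ _ hB]
  exact @measurable_measure_prodMk_left Ω X m mX ρ _ _ (hS.measurable_uncurry_of hst hm hB)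

/-- Applying the flow after time `s` to a random measure determined by the past has, conditionally
on the future, the same mean as applying it to the mean measure. -/
lemma setLIntegral_preimage_eq (hS : IsPerfectFlow P S F H) {s t : ℝ} (hst : s ≤ t)
    (κ : Kernel Ω X) [IsMarkovKernel κ]
    (hκ : ∀ B, MeasurableSet B → Measurable[H s] fun ω => κ ω B)
    (ρ : Measure X) [IsProbabilityMeasure ρ] (hρ : ∀ B, MeasurableSet B → ∫⁻ ω, κ ω B ∂P = ρ B)
    {A : Set Ω} (hA : MeasurableSet[F s] A) {B : Set X} (hB : MeasurableSet B) :
    ∫⁻ ω in A, κ ω (S t s ω ⁻¹' B) ∂P = ∫⁻ ω in A, ρ (S t s ω ⁻¹' B) ∂P := by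
  -- The set `{(ω, x) | ω ∈ A, S(t,s;ω)x ∈ B}` is measurable for the future of `s`, while `κ`
  -- depends on the past of `s`.
  have hfst := @measurable_fst Ω X (F s) mX
  have hC : MeasurableSet[(F s).prod mX] (Prod.fst ⁻¹' A ∩ Function.uncurry (S t s) ⁻¹' B) :=
    (hfst hA).inter
      (hS.measurable_uncurry_of hst (hS.measurable_future s t hst) hB)
  have h := lintegral_kernel_section_eq_of_indep (hS.future_le s) (hS.past_le s) (hS.indep s) κ hκ ρ
    hρ hC
  have hsec : ∀ ω, Prod.mk ω ⁻¹' (Prod.fst ⁻¹' A ∩ Function.uncurry (S t s) ⁻¹' B) =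
      {x | ω ∈ A ∧ S t s ω x ∈ B} := fun ω => rfl
  rw [← lintegral_indicator (hS.future_le s _ hA), ← lintegral_indicator (hS.future_le s _ hA)]
  convert h using 1 <;>
  · refine lintegral_congr fun ω => ?_
    rw [hsec]
    by_cases hω : ω ∈ A <;> simp [hω, Set.preimage]

/-! ### Pullback limits. -/

section Pullback

variable {ρ : ℝ → Measure X} [∀ s, IsProbabilityMeasure (ρ s)]

/-- Invariance of `ρ` under the transition probabilities of the flow. -/
def IsInvariant (P : Measure Ω) (S : ℝ → ℝ → Ω → X → X) (ρ : ℝ → Measure X) : Prop :=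
  ∀ s t, s ≤ t → ∀ B, MeasurableSet B → ∫⁻ ω, ρ s (S t s ω ⁻¹' B) ∂P = ρ t B

omit [IsProbabilityMeasure P] in
lemma lintegral_imageKernel (hS : IsPerfectFlow P S F H) (hρ : IsInvariant P S ρ) {s t : ℝ}
    (hst : s ≤ t) {B : Set X} (hB : MeasurableSet B) :
    ∫⁻ ω, imageKernel (S t s) (ρ s) ω B ∂P = ρ t B := by
  simp only [imageKernel_apply' (hS.measurable_uncurry hst) _ _ hB]
  exact hρ s t hst B hB

/-- This is the martingale identity: `S(t,r)ρ_r` is the image under `S(t,s)` of `S(s,r)ρ_r`, which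
is past-measurable with mean `ρ_s`. -/
lemma setLIntegral_imageKernel (hS : IsPerfectFlow P S F H) (hρ : IsInvariant P S ρ) {r s t : ℝ}
    (hrs : r ≤ s) (hst : s ≤ t) {A : Set Ω} (hA : MeasurableSet[F s] A) {B : Set X}
    (hB : MeasurableSet B) :
    ∫⁻ ω in A, imageKernel (S t s) (ρ s) ω B ∂P = ∫⁻ ω in A, imageKernel (S t r) (ρ r) ω B ∂P := by
  have := isMarkovKernel_imageKernel (hS.measurable_uncurry hrs) (ρ r)
  have h := hS.setLIntegral_preimage_eq hst (imageKernel (S s r) (ρ r))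
    (fun B hB => hS.measurable_imageKernel_of hrs (hS.measurable_past r s hrs) (ρ r) hB) (ρ s)
    (fun B hB => hS.lintegral_imageKernel hρ hrs hB) hA hB
  simp only [imageKernel_apply' (hS.measurable_uncurry hst) _ _ hB,
    imageKernel_apply' (hS.measurable_uncurry (hrs.trans hst)) _ _ hB]
  rw [← h]
  refine lintegral_congr fun ω => ?_
  rw [imageKernel_apply' (hS.measurable_uncurry hrs) _ _
    ((hS.continuous ω s t hst).measurable hB), ← Set.preimage_comp]
  congr 2
  exact funext fun x => hS.flow ω r s t hrs hst x

/-- Along a decreasing sequence of initial times the pulled back measure of a set is a martingale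
for the decreasing family of futures, hence converges almost surely. -/
lemma ae_exists_tendsto_of_antitone (hS : IsPerfectFlow P S F H) (hρ : IsInvariant P S ρ) {t : ℝ}
    {d : ℕ → ℝ} (hd : Antitone d) (hdt : ∀ n, d n ≤ t) {B : Set X} (hB : MeasurableSet B) :
    ∀ᵐ ω ∂P, ∃ c, Tendsto (fun n => imageKernel (S t (d n)) (ρ (d n)) ω B) atTop (𝓝 c) := by
  -- Decreasing times give increasing futures, so the forward martingale convergence theorem
  -- applies.
  let 𝒢 : Filtration ℕ mΩ := ⟨fun n => F (d n), fun i j hij => hS.future_antitone (hd hij),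
    fun n => hS.future_le _⟩
  let f : ℕ → Ω → ℝ := fun n ω => (imageKernel (S t (d n)) (ρ (d n)) ω B).toReal
  have hM : ∀ n, IsMarkovKernel (imageKernel (S t (d n)) (ρ (d n))) := fun n =>
    isMarkovKernel_imageKernel (hS.measurable_uncurry (hdt n)) _
  have hadp : ∀ n, Measurable[F (d n)] fun ω => imageKernel (S t (d n)) (ρ (d n)) ω B := fun n =>
    hS.measurable_imageKernel_of (hdt n) (hS.measurable_future _ t (hdt n)) _ hB
  have hmeas : ∀ n, Measurable fun ω => imageKernel (S t (d n)) (ρ (d n)) ω B := fun n =>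
    (hadp n).mono (hS.future_le _) le_rfl
  have hbound : ∀ n ω, ‖f n ω‖ ≤ 1 := fun n ω => by
    rw [Real.norm_of_nonneg ENNReal.toReal_nonneg]
    exact measureReal_le_one
  have hint : ∀ n, Integrable (f n) P := fun n =>
    Integrable.of_bound (hmeas n).ennreal_toReal.aestronglyMeasurable 1 (.of_forall (hbound n))
  have hmart : Martingale f 𝒢 P := by
    refine martingale_of_setIntegral_eq_succ
      (fun n => (hadp n).ennreal_toReal.stronglyMeasurable) hint fun n A hA => ?_
    rw [integral_toReal (hmeas n).aemeasurable (.of_forall fun ω => measure_lt_top _ _),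
      integral_toReal (hmeas _).aemeasurable (.of_forall fun ω => measure_lt_top _ _),
      hS.setLIntegral_imageKernel hρ (hd n.le_succ) (hdt n) hA hB]
  have hlim := hmart.submartingale.ae_tendsto_limitProcess (R := 1) fun n => by
    refine (eLpNorm_le_of_ae_bound (C := 1) (.of_forall (hbound n))).trans ?_
    simp
  filter_upwards [hlim] with ω hω
  refine ⟨_, (ENNReal.tendsto_ofReal hω).congr fun n => ?_⟩
  exact ENNReal.ofReal_toReal (measure_ne_top _ _)

/-- Almost sure convergence of the pulled back measure of a set, along any sequence of initial
times. -/
lemma ae_exists_tendsto (hS : IsPerfectFlow P S F H) (hρ : IsInvariant P S ρ) {t : ℝ}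
    {u : ℕ → ℝ} (hu : Tendsto u atTop atBot) (hut : ∀ n, u n ≤ t) {B : Set X}
    (hB : MeasurableSet B) :
    ∀ᵐ ω ∂P, ∃ c, Tendsto (fun n => imageKernel (S t (u n)) (ρ (u n)) ω B) atTop (𝓝 c) := by
  obtain ⟨d, k, hd, hdu, hk, hktop⟩ := exists_strictAnti_reindex hu
  filter_upwards [hS.ae_exists_tendsto_of_antitone hρ (t := t) hd.antitone
    (fun n => by obtain ⟨j, hj⟩ := hdu n; exact hj ▸ hut j) hB] with ω ⟨c, hc⟩
  refine ⟨c, (hc.comp hktop).congr fun n => ?_⟩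
  simp only [Function.comp, hk]

/-- Two sequences of initial times lead to the same limit. -/
lemma ae_tendsto_of_ae_tendsto (hS : IsPerfectFlow P S F H) (hρ : IsInvariant P S ρ) {t : ℝ}
    {u v : ℕ → ℝ} (hu : Tendsto u atTop atBot) (hut : ∀ n, u n ≤ t) (hv : Tendsto v atTop atBot)
    (hvt : ∀ n, v n ≤ t) {B : Set X} (hB : MeasurableSet B) {L : Ω → ENNReal}
    (hL : ∀ᵐ ω ∂P, Tendsto (fun n => imageKernel (S t (u n)) (ρ (u n)) ω B) atTop (𝓝 (L ω))) :
    ∀ᵐ ω ∂P, Tendsto (fun n => imageKernel (S t (v n)) (ρ (v n)) ω B) atTop (𝓝 (L ω)) := by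
  -- Interlacing: convergence along `w` forces its even and odd subsequences to share a limit.
  let w : ℕ → ℝ := fun n => if Even n then u (n / 2) else v (n / 2)
  have hhalf : Tendsto (fun n : ℕ => n / 2) atTop atTop :=
    Nat.tendsto_div_const_atTop two_ne_zero
  have hw : Tendsto w atTop atBot := (hu.comp hhalf).if' (hv.comp hhalf)
  have hwt : ∀ n, w n ≤ t := fun n => by
    simp only [w]; split_ifs
    exacts [hut _, hvt _]
  have hw0 : ∀ n, w (2 * n) = u n := fun n => by simp [w]
  have hw1 : ∀ n, w (2 * n + 1) = v n := fun n => by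
    simp only [w, Nat.not_even_bit1, if_false]
    congr 1
    omega
  filter_upwards [hL, hS.ae_exists_tendsto hρ hw hwt hB] with ω h1 ⟨c, hc⟩
  have h2 : Tendsto (fun n : ℕ => 2 * n) atTop atTop :=
    tendsto_atTop_mono (fun n => (by omega : n ≤ 2 * n)) tendsto_id
  have h3 : Tendsto (fun n : ℕ => 2 * n + 1) atTop atTop :=
    tendsto_atTop_mono (fun n => (by omega : n ≤ 2 * n + 1)) tendsto_id
  have h4 : Tendsto (fun n => imageKernel (S t (u n)) (ρ (u n)) ω B) atTop (𝓝 c) :=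
    (hc.comp h2).congr fun n => by simp only [Function.comp, hw0]
  rw [tendsto_nhds_unique h1 h4]
  exact (hc.comp h3).congr fun n => by simp only [Function.comp, hw1]

variable [Nonempty X]

/-- The pullback random measures: they are measurable with respect to the past, have mean `ρ t`, and
are setwise almost sure limits. -/
lemma exists_pullback_kernel (hS : IsPerfectFlow P S F H) (hρ : IsInvariant P S ρ) (t : ℝ) :
    ∃ κ : Kernel Ω X, IsMarkovKernel κ ∧
      (∀ u : ℕ → ℝ, Tendsto u atTop atBot → (∀ n, u n ≤ t) → ∀ B, MeasurableSet B →
        ∀ᵐ ω ∂P, Tendsto (fun n => imageKernel (S t (u n)) (ρ (u n)) ω B) atTop (𝓝 (κ ω B))) ∧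
      (∀ B, MeasurableSet B → ∃ L : Ω → ENNReal, Measurable[H t] L ∧
        (fun ω => κ ω B) =ᵐ[P] L) ∧
      ∀ B, MeasurableSet B → ∫⁻ ω, κ ω B ∂P = ρ t B := by
  let u : ℕ → ℝ := fun n => t - n
  have hut : ∀ n, u n ≤ t := fun n => sub_le_self _ n.cast_nonneg
  have hu : Tendsto u atTop atBot :=
    tendsto_atBot_add_const_left _ t (tendsto_neg_atTop_atBot.comp tendsto_natCast_atTop_atTop)
  have hM : ∀ n, IsMarkovKernel (imageKernel (S t (u n)) (ρ (u n))) := fun n =>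
    isMarkovKernel_imageKernel (hS.measurable_uncurry (hut n)) _
  obtain ⟨κ, hκ, hlim⟩ := exists_kernel_ae_tendsto (P := P) (ρ := ρ t)
    (ν := fun n => imageKernel (S t (u n)) (ρ (u n)))
    (fun B hB => hS.ae_exists_tendsto hρ hu hut hB)
    (fun n B hB => hS.lintegral_imageKernel hρ (hut n) hB)
  refine ⟨κ, hκ, fun v hv hvt B hB => hS.ae_tendsto_of_ae_tendsto hρ hu hut hv hvt hB (hlim B hB),
    fun B hB => ?_, fun B hB => ?_⟩
  -- The construction of `κ` only gives ambient measurability; the limsup is an almost surely equal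
  -- version measurable for the past.
  · refine ⟨fun ω => limsup (fun n => imageKernel (S t (u n)) (ρ (u n)) ω B) atTop,
      Measurable.limsup fun n => hS.measurable_imageKernel_of (hut n)
        (hS.measurable_past _ t (hut n)) _ hB, ?_⟩
    filter_upwards [hlim B hB] with ω hω
    exact hω.limsup_eq.symm
  · have h := tendsto_lintegral_of_dominated_convergence (μ := P) (fun _ => 1)
      (fun n => (imageKernel (S t (u n)) (ρ (u n))).measurable_coe hB)
      (fun n => .of_forall fun ω => prob_le_one) (by simp) (hlim B hB)
    simp only [hS.lintegral_imageKernel hρ (hut _) hB] at h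
    exact tendsto_nhds_unique h tendsto_const_nhds

-- A countable determining family merges the null sets, one for each `B`, into a single one.
omit [IsProbabilityMeasure P] [Nonempty X] in
lemma weaklyConverges_imageKernel (hS : IsPerfectFlow P S F H)
    {t : ℝ} {κ : Kernel Ω X} [IsMarkovKernel κ] {u : ℕ → ℝ} (hut : ∀ n, u n ≤ t)
    (hκ : ∀ B, MeasurableSet B →
        ∀ᵐ ω ∂P, Tendsto (fun n => imageKernel (S t (u n)) (ρ (u n)) ω B) atTop (𝓝 (κ ω B))) :
    ∀ᵐ ω ∂P, WeaklyConverges (fun n => (ρ (u n)).map (S t (u n) ω)) (κ ω) := by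
  obtain ⟨𝒰, hc, hmeas, hdet⟩ := exists_countable_weakConvergenceDetermining X
  filter_upwards [(ae_ball_iff hc).2 fun U hU => hκ U (hmeas U hU)] with ω hω
  refine hdet _ _ (.of_forall fun n => ?_) inferInstance fun U hU => ?_
  · exact Measure.isProbabilityMeasure_map (hS.continuous ω _ _ (hut n)).measurable.aemeasurable
  · simpa only [imageKernel_apply (hS.measurable_uncurry (hut _))] using hω U hU

omit [IsProbabilityMeasure P] [Nonempty X] in
/-- The pullback random measures are transported by the flow. -/
lemma ae_map_pullback_eq (hS : IsPerfectFlow P S F H) {κ : ℝ → Kernel Ω X}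
    [∀ t, IsMarkovKernel (κ t)]
    (hκ : ∀ t (u : ℕ → ℝ), Tendsto u atTop atBot → (∀ n, u n ≤ t) → ∀ B, MeasurableSet B →
      ∀ᵐ ω ∂P, Tendsto (fun n => imageKernel (S t (u n)) (ρ (u n)) ω B) atTop (𝓝 (κ t ω B)))
    {s t : ℝ} (hst : s ≤ t) : ∀ᵐ ω ∂P, (κ s ω).map (S t s ω) = κ t ω := by
  let u : ℕ → ℝ := fun n => s - n
  have hus : ∀ n, u n ≤ s := fun n => sub_le_self _ n.cast_nonneg
  have hu : Tendsto u atTop atBot :=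
    tendsto_atBot_add_const_left _ s (tendsto_neg_atTop_atBot.comp tendsto_natCast_atTop_atTop)
  filter_upwards [hS.weaklyConverges_imageKernel hus (hκ s u hu hus),
    hS.weaklyConverges_imageKernel (fun n => (hus n).trans hst)
      (hκ t u hu fun n => (hus n).trans hst)] with ω h1 h2
  have hcont := hS.continuous ω s t hst
  have hprob : IsProbabilityMeasure ((κ s ω).map (S t s ω)) :=
    Measure.isProbabilityMeasure_map hcont.measurable.aemeasurable
  refine ext_of_forall_integral_eq_of_IsFiniteMeasure fun f => ?_
  -- Test the convergence at time `s` on `f ∘ S(t,s;ω)`: by the flow property these are the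
  -- integrals of `f` that converge at time `t`.
  refine tendsto_nhds_unique ?_ (h2 f)
  rw [integral_map hcont.measurable.aemeasurable f.continuous.aestronglyMeasurable]
  refine (h1 (f.compContinuous ⟨_, hcont⟩)).congr fun n => ?_
  rw [integral_map (hS.continuous ω _ _ (hus n)).measurable.aemeasurable
      (BoundedContinuousFunction.continuous _).aestronglyMeasurable,
    integral_map (hS.continuous ω _ _ ((hus n).trans hst)).measurable.aemeasurable
      f.continuous.aestronglyMeasurable]
  refine integral_congr_ae (.of_forall fun x => ?_)
  simp [hS.flow ω _ _ _ (hus n) hst]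

end Pullback

end IsPerfectFlow

/-! ### Passing to a perfect version of the flow. -/

variable {Ω X : Type*} {m m' : MeasurableSpace Ω} [mΩ : MeasurableSpace Ω] [mX : MeasurableSpace X]
  {P : Measure Ω} {S S' : ℝ → ℝ → Ω → X → X}

lemma completion_mono (h : m ≤ m') : completion P m ≤ completion P m' :=
  fun _ ⟨t, ht, hst⟩ => ⟨t, h t ht, hst⟩

lemma future_antitone : Antitone (future P S) := fun _ _ hss' =>
  completion_mono <| iSup_mono fun _ => iSup_mono fun _ =>
    iSup_le fun h => le_iSup_of_le (hss'.trans h) le_rfl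

/-- Completeness of the future lets the flow be modified on a null set without losing adaptedness.
-/
lemma measurable_future_of_ae_eq {s t : ℝ} (hst : s ≤ t) {x : X} {g : Ω → X}
    (hg : g =ᵐ[P] fun ω => S t s ω x) : Measurable[future P S s] g := by
  refine Measurable.eventuallyMeasurable_of_eventuallyEq ?_ hg
  refine Measurable.mono (comap_measurable _) ?_ le_rfl
  exact le_iSup_of_le s <| le_iSup_of_le t <| le_iSup_of_le le_rfl <| le_iSup_of_le hst <|
    le_iSup_of_le x le_rfl

lemma measurable_past_of_ae_eq {s t : ℝ} (hst : s ≤ t) {x : X} {g : Ω → X}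
    (hg : g =ᵐ[P] fun ω => S t s ω x) : Measurable[past P S t] g := by
  refine Measurable.eventuallyMeasurable_of_eventuallyEq ?_ hg
  refine Measurable.mono (comap_measurable _) ?_ le_rfl
  exact le_iSup_of_le s <| le_iSup_of_le t <| le_iSup_of_le hst <| le_iSup_of_le le_rfl <|
    le_iSup_of_le x le_rfl

omit mΩ in
lemma measurable_inf {β : Type*} [MeasurableSpace β] {f : Ω → β}
    (h : Measurable[m] f) (h' : Measurable[m'] f) : Measurable[m ⊓ m'] f :=
  fun _ hs => MeasurableSpace.measurableSet_inf.2 ⟨h hs, h' hs⟩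

lemma IsDisintegration.eq_compProd [IsProbabilityMeasure P] {μ : Measure (Ω × X)}
    {κ : Kernel Ω X} (h : IsDisintegration P μ κ) : μ = P ⊗ₘ κ := by
  have := h.isMarkovKernel
  have hfin : IsFiniteMeasure μ := ⟨by
    rw [← Set.univ_prod_univ, h.prod_apply _ _ .univ .univ]
    simp⟩
  refine Measure.ext_prod fun {A B} hA hB => ?_
  rw [h.prod_apply A B hA hB, Measure.compProd_apply_prod hA hB]

omit mX in
lemma markovOp_congr (hae : ∀ᵐ ω ∂P, ∀ s t, s ≤ t → S' t s ω = S t s ω)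
    {s t : ℝ} (hst : s ≤ t) (f : X → ℝ) :
    markovOp P S s t f = markovOp P S' s t f := by
  ext x
  exact integral_congr_ae (hae.mono fun ω h => by simp only [h s t hst])

variable [TopologicalSpace X]

/-- A white noise flow is almost surely equal to one whose properties hold for every `ω`. -/
lemma IsWhiteNoiseFlow.exists_isPerfectFlow (hS : IsWhiteNoiseFlow P S) :
    ∃ S' : ℝ → ℝ → Ω → X → X,
      IsPerfectFlow P S' (fun s => future P S s ⊓ mΩ) (fun s => past P S s ⊓ mΩ) ∧
      ∀ᵐ ω ∂P, ∀ s t, s ≤ t → S' t s ω = S t s ω := by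
  classical
  obtain ⟨G, hG0, hG, hGsub⟩ := Filter.Eventually.exists_measurable_mem hS.ae_flow
  -- The identity flow off a measurable set of full measure satisfies the flow and continuity
  -- requirements trivially.
  let S' : ℝ → ℝ → Ω → X → X := fun t s ω x => if ω ∈ G then S t s ω x else x
  have hin : ∀ {ω}, ω ∈ G → ∀ t s x, S' t s ω x = S t s ω x := fun h t s x => if_pos h
  have hout : ∀ {ω}, ω ∉ G → ∀ t s x, S' t s ω x = x := fun h t s x => if_neg h
  have hae : ∀ᵐ ω ∂P, ∀ s t x, S' t s ω x = S t s ω x := by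
    filter_upwards [hG0] with ω hω s t x using hin hω t s x
  have hmeas : ∀ s t, s ≤ t → ∀ x, Measurable fun ω => S' t s ω x := fun s t hst x =>
    Measurable.ite hG ((hS.measurable_flow t x).comp
      (g := fun p : Set.Iic t × Ω => S t p.1 p.2 x) (f := fun ω => ((⟨s, hst⟩ : Set.Iic t), ω))
      measurable_prodMk_left) measurable_const
  -- `P` need not be complete, so the completed σ-algebras may exceed the ambient one; hence the
  -- intersections with `mΩ`.
  refine ⟨S', ⟨fun s => inf_le_right, fun s => inf_le_right,
    fun s s' h => inf_le_inf_right _ (future_antitone h), fun s => ?_, ?_, ?_, ?_, ?_⟩, ?_⟩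
  · exact indep_of_indep_of_le_left (indep_of_indep_of_le_right (hS.indep s) inf_le_left)
      inf_le_left
  · intro ω s r t hsr hrt x
    by_cases h : ω ∈ G
    · simpa only [hin h] using (hGsub _ h).1 s r t hsr hrt x
    · simp only [hout h]
  · intro ω s t hst
    by_cases h : ω ∈ G
    · exact ((hGsub _ h).2.1 s t hst).congr fun x => (hin h t s x).symm
    · exact continuous_id.congr fun x => (hout h t s x).symm
  · exact fun s t hst x => measurable_inf
      (measurable_future_of_ae_eq hst (hae.mono fun ω h => h s t x)) (hmeas s t hst x)
  · exact fun s t hst x => measurable_inf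
      (measurable_past_of_ae_eq hst (hae.mono fun ω h => h s t x)) (hmeas s t hst x)
  · filter_upwards [hae] with ω hω s t _ using funext fun x => hω s t x

/-! ### Evolution systems in terms of the perfect version. -/

section Transfer

variable [PolishSpace X] [BorelSpace X] [IsProbabilityMeasure P]
  {F H : ℝ → MeasurableSpace Ω} (hS' : IsPerfectFlow P S' F H)
  (hae : ∀ᵐ ω ∂P, ∀ s t, s ≤ t → S' t s ω = S t s ω)
include hS' hae

lemma IsMarkovEvolutionSystem.isInvariant {ρ : ℝ → Measure X}
    (hρ : IsMarkovEvolutionSystem (markovOp P S) ρ) : IsPerfectFlow.IsInvariant P S' ρ := by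
  intro s t hst B hB
  have := hρ.isProbabilityMeasure
  have hC : MeasurableSet (Function.uncurry (S' t s) ⁻¹' B) := hS'.measurable_uncurry hst hB
  have h1 := Measure.prod_apply (μ := P) (ν := ρ s) hC
  have h2 := Measure.prod_apply_symm (μ := P) (ν := ρ s) hC
  have h3 := hρ.image_eq s t hst (B.indicator 1) (measurable_one.indicator hB)
    ⟨1, fun x => by by_cases hx : x ∈ B <;> simp [hx]⟩
  rw [integral_indicator_one hB, markovOp_congr hae hst] at h3
  have h4 : ∀ x, markovOp P S' s t (B.indicator 1) x =
      (P ((fun ω => (ω, x)) ⁻¹' (Function.uncurry (S' t s) ⁻¹' B))).toReal := fun x =>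
    integral_indicator_one (μ := P) (measurable_prodMk_right hC)
  simp only [h4] at h3
  rw [integral_toReal (measurable_measure_prodMk_right hC).aemeasurable
    (.of_forall fun x => measure_lt_top _ _), ← h2] at h3
  refine h1.symm.trans ?_
  exact ((ENNReal.toReal_eq_toReal_iff' (measure_ne_top _ _) (measure_ne_top _ _)).1 h3).symm

lemma IsPerfectFlow.IsInvariant.isMarkovEvolutionSystem {ρ : ℝ → Measure X}
    [hρ' : ∀ s, IsProbabilityMeasure (ρ s)] (hρ : IsPerfectFlow.IsInvariant P S' ρ) :
    IsMarkovEvolutionSystem (markovOp P S) ρ := by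
  refine ⟨hρ', fun s t hst f hf ⟨C, hC⟩ => ?_⟩
  have hm := hS'.measurable_uncurry hst
  have hmap : ρ t = (P.prod (ρ s)).map (Function.uncurry (S' t s)) := by
    ext B hB
    rw [Measure.map_apply hm hB, Measure.prod_apply (hm hB), ← hρ s t hst B hB]
    rfl
  rw [markovOp_congr hae hst, hmap, integral_map hm.aemeasurable hf.aestronglyMeasurable,
    integral_prod_symm]
  · rfl
  · exact Integrable.of_bound (hf.comp hm).aestronglyMeasurable C (.of_forall fun p => hC _)

/-- `S` itself may fail to be jointly measurable. As `μ` has marginal `P`, the map agrees `μ`-almost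
everywhere with its measurable version built from `S'`. -/
lemma map_compProd_apply_prod {μ : Measure (Ω × X)} {κ : Kernel Ω X} [IsMarkovKernel κ]
    (hμ : μ = P ⊗ₘ κ) {s t : ℝ} (hst : s ≤ t) {A : Set Ω} (hA : MeasurableSet A) {B : Set X}
    (hB : MeasurableSet B) :
    μ.map (fun p => (p.1, S t s p.1 p.2)) (A ×ˢ B) = ∫⁻ ω in A, κ ω (S' t s ω ⁻¹' B) ∂P := by
  have hm := hS'.measurable_uncurry hst
  have hfst : μ.map Prod.fst = P := by
    rw [hμ]
    exact Measure.fst_compProd P κ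
  have hcongr : (fun p : Ω × X => (p.1, S t s p.1 p.2)) =ᵐ[μ]
      fun p => (p.1, Function.uncurry (S' t s) p) := by
    rw [← hfst] at hae
    filter_upwards [ae_of_ae_map measurable_fst.aemeasurable hae] with p hp
    simp [Function.uncurry, hp s t hst]
  have hΦ : Measurable fun p : Ω × X => (p.1, Function.uncurry (S' t s) p) :=
    measurable_fst.prodMk hm
  rw [Measure.map_congr hcongr, Measure.map_apply hΦ (hA.prod hB), hμ,
    Measure.compProd_apply (hΦ (hA.prod hB)), ← lintegral_indicator hA]
  refine lintegral_congr fun ω => ?_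
  by_cases hω : ω ∈ A <;> simp [hω, Set.preimage, Function.uncurry]

end Transfer

end StochFlow

/-! ### The theorem. -/

theorem theorem1p1 {Ω X : Type*} [MeasurableSpace Ω] (P : Measure Ω) [IsProbabilityMeasure P]
    [TopologicalSpace X] [PolishSpace X] [MeasurableSpace X] [BorelSpace X]
    (S : ℝ → ℝ → Ω → X → X) (hS : StochFlow.IsWhiteNoiseFlow P S) :
    (∀ ρ : ℝ → Measure X, StochFlow.IsMarkovEvolutionSystem (StochFlow.markovOp P S) ρ →
      ∃ (μ : ℝ → Measure (Ω × X)) (κ : ℝ → Kernel Ω X),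
        (∀ t : ℝ, StochFlow.IsDisintegration P (μ t) (κ t)) ∧
        (∀ (t : ℝ) (s : ℕ → ℝ), Tendsto s atTop atBot →
          ∀ᵐ ω ∂P, StochFlow.WeaklyConverges (fun n => (ρ (s n)).map (S t (s n) ω)) (κ t ω)) ∧
        StochFlow.IsFlowEvolutionSystem P S μ ∧
        (∀ t : ℝ, StochFlow.IsPastMeasurable P S t (κ t)) ∧
        (∀ (t : ℝ) (B : Set X), MeasurableSet B → ∫⁻ ω, κ t ω B ∂P = ρ t B)) ∧
    (∀ (μ : ℝ → Measure (Ω × X)) (κ : ℝ → Kernel Ω X),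
      StochFlow.IsFlowEvolutionSystem P S μ →
      (∀ t : ℝ, StochFlow.IsDisintegration P (μ t) (κ t)) →
      (∀ t : ℝ, StochFlow.IsPastMeasurable P S t (κ t)) →
      ∃ ρ : ℝ → Measure X,
        (∀ (t : ℝ) (B : Set X), MeasurableSet B → ρ t B = ∫⁻ ω, κ t ω B ∂P) ∧
        StochFlow.IsMarkovEvolutionSystem (StochFlow.markovOp P S) ρ) := by

  obtain ⟨S', hS', hae⟩ := hS.exists_isPerfectFlow
  refine ⟨fun ρ hρ => ?_, fun μ κ hμ hκ hpast => ?_⟩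
  · have := hρ.isProbabilityMeasure
    have : Nonempty X := nonempty_of_isProbabilityMeasure (ρ 0)
    have hinv := hρ.isInvariant hS' hae
    choose κ hκ hlim hpast hmean using hS'.exists_pullback_kernel hinv
    refine ⟨fun t => P ⊗ₘ κ t, κ, fun t => ⟨hκ t, fun A B hA hB =>
      Measure.compProd_apply_prod hA hB⟩, fun t s hs => ?_, ⟨fun t => inferInstance,
      fun t => Measure.fst_compProd P (κ t), fun s t hst => ?_⟩, fun t B hB => ?_, hmean⟩
    -- Finitely many `s n` may exceed `t`, where the flow is meaningless; truncation at `t` changes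
    -- only these terms.
    · have hmin : Tendsto (fun n => min (s n) t) atTop atBot :=
        tendsto_atBot_mono (fun n => min_le_left _ _) hs
      filter_upwards [hae, hS'.weaklyConverges_imageKernel (fun n => min_le_right (s n) t)
        (hlim t _ hmin fun n => min_le_right _ _)] with ω hω hw f
      refine (hw f).congr' ?_
      filter_upwards [hs.eventually (eventually_le_atBot t)] with n hn
      rw [min_eq_left hn, hω _ _ hn]
    · refine Measure.ext_prod fun {A B} hA hB => ?_
      rw [StochFlow.map_compProd_apply_prod hS' hae rfl hst hA hB,
        Measure.compProd_apply_prod hA hB]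
      refine lintegral_congr_ae (ae_restrict_of_ae ?_)
      filter_upwards [hS'.ae_map_pullback_eq hlim hst] with ω hω
      rw [← hω, Measure.map_apply (hS'.continuous ω s t hst).measurable hB]
    · obtain ⟨L, hL, hLκ⟩ := hpast t B hB
      exact EventuallyMeasurable.congr (hL.mono inf_le_left le_rfl) hLκ
  · have hM : ∀ t, IsMarkovKernel (κ t) := fun t => (hκ t).isMarkovKernel
    let ρ : ℝ → Measure X := fun t => P.bind (κ t)
    have hρ : ∀ t B, MeasurableSet B → ρ t B = ∫⁻ ω, κ t ω B ∂P := fun t B hB =>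
      Measure.bind_apply hB (κ t).measurable.aemeasurable
    have hprob : ∀ t, IsProbabilityMeasure (ρ t) := fun t => ⟨by rw [hρ t _ .univ]; simp⟩
    refine ⟨ρ, hρ, StochFlow.IsPerfectFlow.IsInvariant.isMarkovEvolutionSystem hS' hae
      fun s t hst B hB => ?_⟩
    -- Independence on all of `Ω` turns the mean of `S(t,s)μ_{sω}` into that of `S(t,s)ρ_s`; by
    -- evolution of `μ` (`h2`) it is also `ρ_t`.
    have h1 := hS'.setLIntegral_preimage_eq hst (κ s)
      (fun B hB => StochFlow.measurable_inf (hpast s B hB) ((κ s).measurable_coe hB)) (ρ s)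
      (fun B hB => (hρ s B hB).symm) .univ hB
    have h2 := StochFlow.map_compProd_apply_prod hS' hae (hκ s).eq_compProd hst .univ hB
    rw [hμ.map_flow s t hst, (hκ t).prod_apply _ _ .univ hB] at h2
    simp only [Measure.restrict_univ] at h1 h2
    rw [← h1, ← h2, hρ t B hB]
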